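/- Consider $N\ge 2$ agents with scalar states $x_k(t)\in\mathbb{R}$ and dynamics $\dot x_k=u_k$, $k=1,\dots,N$, interacting over a digraph $\mathscr{G}$ without self-loops on the nodes $1,\dots,N$, with weighted adjacency matrix $[w_{kl}]\in\mathbb{R}^{N\times N}$, where $w_{kl}\ne 0$ if there is an edge from $l$ to $k$, and $w_{kl}=0$ otherwise. Let $\mathcal{N}_k=\{l: w_{kl}\neq 0\}$. Fix $\rho_1>0$, $\rho_2>0$, $\kappa>0$ and a prescribed time $T_1>0$, and apply the protocol $$u_k=\Bigl(\rho_1+\rho_2\frac{\dot\varphi(t,T_1)}{\varphi(t,T_1)}\Bigr)\sum_{l\in\mathcal{N}_k}w_{kl}\bigl[x_l-\operatorname{sign}(w_{kl})x_k\bigr],$$ where $\varphi(t,T_1)=T_1^{\kappa}/(T_1-t)^{\kappa}$ and $\dot\varphi(t,T_1)=\frac{\kappa}{T_1}\varphi(t,T_1)^{1+1/\kappa}$ for $t\in[0,T_1)$, while $\varphi(t,T_1)=1$ and $\dot\varphi(t,T_1)=0$ for $t\ge T_1$. A closed strong component (CSC) of $\mathscr{G}$ is a maximal strongly connected subgraph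 with no incoming edges from nodes outside it. An agent is a leader if its node lies in some CSC, and a follower otherwise; $\mathcal{L}$ denotes the set of leaders. Suppose that $\mathscr{G}$ is weakly connected and that all its edge weights are positive. Then every trajectory of the closed-loop system, that is, every function $x=(x_1,\dots,x_N)$ that is continuous on $[0,\infty)$ and satisfies the differential equation at every $t\ge 0$, $t\ne T_1$ (with the right-hand derivative at $t=0$), has the following properties, whatever its initial state. 1. The leaders in each CSC reach consensus in the prescribed time $T_1$: for every CSC there is $c\in\mathbb{R}$ such that $\lim_{t\to T_1}x_k(t)=c$ and $x_k(t)=c$ for all $t\ge T_1$, for every node $k$ of that CSC. 2. The followers converge to the convex hull of the leaders' states in the prescribed time $T_1$: for every follower $l$, the limit $\lim_{t\to T_1}x_l(t)$ exists and lies in the convex hull of $\{\lim_{t\to T_1}x_k(t):k\in\mathcal{L}\}$, and $x_l(t)$ lies in the convex hull of $\{x_k(t):k\in\mathcal{L}\}$ for all $t\ge T_1$. -/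

import Mathlib

open Filter Topology

noncomputable section

/-- A signed digraph without self-loops on the node set `V`, given by its weighted adjacency
matrix: `W k l ≠ 0` exactly when there is an edge from `l` to `k`. -/
structure SignedDigraph (V : Type*) where
  W : Matrix V V ℝ
  no_self_loop : ∀ k, W k k = 0

namespace SignedDigraph

variable {V : Type*}

/-- `(a, b)` is an edge, directed from `a` to `b`. -/
def Edge (G : SignedDigraph V) (a b : V) : Prop := G.W b a ≠ 0

/-- There is a directed path from `a` to `b`. (The trivial path is allowed; deleting cycles from
a walk gives a path with pairwise distinct nodes.) -/
def HasPath (G : SignedDigraph V) (a b : V) : Prop := Relation.ReflTransGen G.Edge a b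

/-- There are paths between every two distinct nodes. -/
def StronglyConnected (G : SignedDigraph V) : Prop := ∀ a b, a ≠ b → G.HasPath a b

/-- The graph obtained by replacing each edge with an undirected one is connected. -/
def WeaklyConnected (G : SignedDigraph V) : Prop := (SimpleGraph.fromRel G.Edge).Connected

/-- Every edge of the digraph has positive weight. -/
def PositiveWeights (G : SignedDigraph V) : Prop := ∀ a b, G.Edge a b → 0 < G.W b a

/-- The subgraph on the nodes of `S`, with all the edges between them. -/
def induce (G : SignedDigraph V) (S : Set V) : SignedDigraph S where
  W := fun k l => G.W k l
  no_self_loop := fun k => G.no_self_loop k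

/-- `S` is the node set of a closed strong component: a maximal (nonempty) strongly connected
subgraph with no incoming edges from nodes outside. -/
def IsClosedStrongComponent (G : SignedDigraph V) (S : Set V) : Prop :=
  Maximal (fun U : Set V => U.Nonempty ∧ (G.induce U).StronglyConnected) S ∧
    ∀ a ∉ S, ∀ b ∈ S, ¬ G.Edge a b

/-- The leaders: the nodes lying in some closed strong component. -/
def leaders (G : SignedDigraph V) : Set V := {k | ∃ S, G.IsClosedStrongComponent S ∧ k ∈ S}

/-- The followers: all the other nodes. -/
def followers (G : SignedDigraph V) : Set V := G.leadersᶜ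

open Classical in
/-- The in-neighbours of the node `k`. -/
def inNeighbors [Fintype V] (G : SignedDigraph V) (k : V) : Finset V :=
  Finset.univ.filter fun l => G.Edge l k

end SignedDigraph

/-- The time-varying scaling function `φ(t, T)` with exponent `κ`. -/
def phi (κ T t : ℝ) : ℝ := if t < T then T ^ κ / (T - t) ^ κ else 1

/-- The time derivative of `φ(t, T)` (the right-hand one at `t = T`). -/
def phiDot (κ T t : ℝ) : ℝ := if t < T then κ / T * phi κ T t ^ (1 + 1 / κ) else 0

/-- The control input of agent `k` at time `t`, when the agents are in the states `y`. -/
def protocol {V : Type*} [Fintype V] (G : SignedDigraph V) (ρ₁ ρ₂ κ T : ℝ) (t : ℝ) (y : V → ℝ)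
    (k : V) : ℝ :=
  (ρ₁ + ρ₂ * (phiDot κ T t / phi κ T t)) *
    ∑ l ∈ G.inNeighbors k, G.W k l * (y l - Real.sign (G.W k l) * y k)

/-- `x` is a trajectory on `[0, ∞)` of the single-integrator network `ẋₖ = uₖ` under the protocol:
it is continuous on `[0, ∞)` and satisfies the differential equation (with a one-sided derivative
at `0`) at all times other than the switching instant `T`, where the gain is unbounded from the
left and the state need not have a two-sided derivative. -/
structure IsTrajectory {V : Type*} [Fintype V] (G : SignedDigraph V) (ρ₁ ρ₂ κ T : ℝ)
    (x : ℝ → V → ℝ) : Prop where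
  continuousOn : ContinuousOn x (Set.Ici 0)
  hasDeriv : ∀ t, 0 ≤ t → t ≠ T → ∀ k,
    HasDerivWithinAt (fun s => x s k) (protocol G ρ₁ ρ₂ κ T t (x t) k) (Set.Ici 0) t

/-- The agents of `S` reach consensus in the prescribed time `T`: their states tend to a common
value as `t → T`, and equal it from time `T` on. -/
def PrescribedTimeConsensus {V : Type*} (x : ℝ → V → ℝ) (T : ℝ) (S : Set V) : Prop :=
  ∃ c : ℝ, ∀ k ∈ S, Tendsto (fun t => x t k) (𝓝 T) (𝓝 c) ∧ ∀ t, T ≤ t → x t k = c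

/-- The agents of `F` converge to the convex hull of the states of the agents of `L` in the
prescribed time `T`: as `t → T` they have limits, which lie in the convex hull of the limits of
the states of `L`, and from time `T` on they lie in the convex hull of the states of `L`. -/
def PrescribedTimeContainment {V : Type*} (x : ℝ → V → ℝ) (T : ℝ) (L F : Set V) : Prop :=
  ∀ l ∈ F,
    (∃ d : ℝ, Tendsto (fun t => x t l) (𝓝 T) (𝓝 d) ∧
      d ∈ convexHull ℝ {c : ℝ | ∃ k ∈ L, Tendsto (fun t => x t k) (𝓝 T) (𝓝 c)}) ∧
    ∀ t, T ≤ t → x t l ∈ convexHull ℝ ((fun k => x t k) '' L)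

end

/-! With positive weights the protocol is the Laplacian flow `G.diffusion` times a gain, which is
`ρ₁ + ρ₂ * (κ / (T - t))` before `T`. This gain is not integrable up to `T`, while a trajectory is
continuous there; so a nonzero component of `G.diffusion (x T)` would drive the state off
logarithmically (`not_continuousAt_of_div_le_deriv`). Hence `x T` is harmonic (`diffusion_eq_zero`),
and as an equilibrium of the autonomous flow after `T` it persists (`eq_of_le`). The rest is a
maximum principle: extrema of a harmonic state propagate backwards along paths. This makes it
constant on each closed strong component and, as every node is reached from a leader, places its
extrema at leaders. -/

namespace SignedDigraph

variable {V : Type*} {G : SignedDigraph V}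

/-! ### Paths and closed strong components -/

theorem PositiveWeights.nonneg (hpos : G.PositiveWeights) (k l : V) : 0 ≤ G.W k l := by
  by_cases h : G.W k l = 0
  · exact h.ge
  · exact (hpos l k h).le

/-- A directed path inside an induced subgraph is a directed path of the whole graph. -/
theorem HasPath.of_induce {S : Set V} {a b : S} (h : (G.induce S).HasPath a b) :
    G.HasPath a b :=
  Relation.ReflTransGen.lift (r := (G.induce S).Edge) (p := G.Edge) Subtype.val
    (fun _ _ e => e) _ _ h

/-- If all ancestors of nodes of `S` lie in `S`, then directed paths ending in `S` stay in `S`. -/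
theorem HasPath.induce_of_closed {S : Set V} (hS : ∀ a, ∀ b ∈ S, G.Edge a b → a ∈ S)
    {a b : V} (h : G.HasPath a b) (hb : b ∈ S) :
    ∃ ha : a ∈ S, (G.induce S).HasPath ⟨a, ha⟩ ⟨b, hb⟩ := by
  induction h using Relation.ReflTransGen.head_induction_on with
  | refl => exact ⟨hb, Relation.ReflTransGen.refl⟩
  | head e _ ih =>
    obtain ⟨hc, p⟩ := ih
    have e' : (G.induce S).Edge ⟨_, hS _ _ hc e⟩ ⟨_, hc⟩ := e
    exact ⟨hS _ _ hc e, Relation.ReflTransGen.head e' p⟩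

/-- A node that is an ancestor of all its ancestors determines a closed strong component. -/
theorem isClosedStrongComponent_ancestors {a : V}
    (ha : ∀ b, G.HasPath b a → G.HasPath a b) :
    G.IsClosedStrongComponent {b | G.HasPath b a} := by
  have hcl : ∀ b, ∀ c ∈ {b | G.HasPath b a}, G.Edge b c → b ∈ {b | G.HasPath b a} :=
    fun b c hc e => Relation.ReflTransGen.head e hc
  refine ⟨⟨⟨⟨a, Relation.ReflTransGen.refl⟩, ?_⟩, ?_⟩, fun b hb c hc e => hb (hcl b c hc e)⟩
  · rintro ⟨b, hb⟩ ⟨c, hc⟩ -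
    exact (HasPath.induce_of_closed hcl
      (Relation.ReflTransGen.trans hb (ha c hc) : G.HasPath b c) hc).2
  · rintro U ⟨-, hU⟩ hle u hu
    have haU : a ∈ U := hle Relation.ReflTransGen.refl
    by_cases h : u = a
    · exact h ▸ Relation.ReflTransGen.refl
    · exact (hU ⟨u, hu⟩ ⟨a, haU⟩ fun e => h (congrArg Subtype.val e)).of_induce

/-- In a finite digraph every node can be reached from some leader. -/
theorem exists_leader_hasPath [Finite V] (G : SignedDigraph V) (k : V) :
    ∃ l ∈ G.leaders, G.HasPath l k := by
  -- Take an ancestor `a` of `k` with fewest ancestors: any ancestor `b` of `a` then has the same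
  -- ancestors as `a`, in particular `a` itself.
  obtain ⟨a, hak, hmin⟩ := Set.exists_min_image {a | G.HasPath a k}
    (fun a => {b | G.HasPath b a}.ncard) (Set.toFinite _) ⟨k, Relation.ReflTransGen.refl⟩
  refine ⟨a, ⟨_, isClosedStrongComponent_ancestors fun b hb => ?_,
    Relation.ReflTransGen.refl⟩, hak⟩
  have hsub : {c | G.HasPath c b} ⊆ {c | G.HasPath c a} :=
    fun c hc => Relation.ReflTransGen.trans hc hb
  have heq := Set.eq_of_subset_of_ncard_le hsub
    (hmin b (Relation.ReflTransGen.trans hb hak)) (Set.toFinite _)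
  exact heq.symm.subset (Relation.ReflTransGen.refl : G.HasPath a a)

/-! ### Harmonic states and the maximum principle -/

section Laplacian

variable [Fintype V]

/-- The negative Laplacian flow field `-L y` of the weighted digraph. -/
def diffusion (G : SignedDigraph V) (y : V → ℝ) (k : V) : ℝ := ∑ l, G.W k l * (y l - y k)

theorem continuous_diffusion (G : SignedDigraph V) : Continuous G.diffusion := by
  unfold diffusion
  fun_prop

theorem diffusion_neg (G : SignedDigraph V) (y : V → ℝ) (k : V) :
    G.diffusion (-y) k = -G.diffusion y k := by
  simp only [diffusion, Pi.neg_apply, ← Finset.sum_neg_distrib]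
  exact Finset.sum_congr rfl fun _ _ => by ring

/-- The negative Laplacian as a continuous linear map. -/
def diffusionCLM (G : SignedDigraph V) : (V → ℝ) →L[ℝ] (V → ℝ) where
  toFun := G.diffusion
  map_add' y z := by
    ext k
    simp only [diffusion, Pi.add_apply, ← Finset.sum_add_distrib]
    exact Finset.sum_congr rfl fun _ _ => by ring
  map_smul' c y := by
    ext k
    simp only [diffusion, Pi.smul_apply, smul_eq_mul, RingHom.id_apply, Finset.mul_sum]
    exact Finset.sum_congr rfl fun _ _ => by ring
  cont := G.continuous_diffusion

/-- With positive weights the control input is the diffusion scaled by the time-varying gain. -/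
theorem protocol_eq_diffusion (hpos : G.PositiveWeights) (ρ₁ ρ₂ κ T t : ℝ) (y : V → ℝ) (k : V) :
    protocol G ρ₁ ρ₂ κ T t y k =
      (ρ₁ + ρ₂ * (phiDot κ T t / phi κ T t)) * G.diffusion y k := by
  classical
  unfold protocol diffusion inNeighbors
  congr 1
  rw [Finset.sum_filter]
  refine Finset.sum_congr rfl fun l _ => ?_
  split_ifs with h
  · rw [Real.sign_of_pos (hpos _ _ h), one_mul]
  · rw [not_not.mp h, zero_mul]

/-- Strong maximum principle: a maximum of a harmonic state propagates to the in-neighbours. -/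
theorem eq_of_edge_of_isMax (hpos : G.PositiveWeights) {y : V → ℝ} {k l : V}
    (hk : G.diffusion y k = 0) (hmax : ∀ j, G.Edge j k → y j ≤ y k) (e : G.Edge l k) :
    y l = y k := by
  have hterm : ∀ j ∈ Finset.univ, G.W k j * (y j - y k) ≤ 0 := fun j _ => by
    by_cases hj : G.Edge j k
    · exact mul_nonpos_of_nonneg_of_nonpos (hpos.nonneg k j) (sub_nonpos.mpr (hmax j hj))
    · rw [not_not.mp hj, zero_mul]
  have hl := (Finset.sum_eq_zero_iff_of_nonpos hterm).mp hk l (Finset.mem_univ l)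
  exact sub_eq_zero.mp ((mul_eq_zero.mp hl).resolve_left e)

/-- On a set without incoming edges, a maximum of a harmonic state propagates backwards along
directed paths. -/
theorem eq_of_hasPath_of_isMaxOn (hpos : G.PositiveWeights) {y : V → ℝ}
    (hy : G.diffusion y = 0) {S : Set V} (hS : ∀ a, ∀ b ∈ S, G.Edge a b → a ∈ S) {k l : V}
    (hk : k ∈ S) (hmax : ∀ j ∈ S, y j ≤ y k) (p : G.HasPath l k) : y l = y k := by
  suffices h : l ∈ S ∧ y l = y k from h.2
  induction p using Relation.ReflTransGen.head_induction_on with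
  | refl => exact ⟨hk, rfl⟩
  | head e _ ih =>
    obtain ⟨hc, h⟩ := ih
    refine ⟨hS _ _ hc e, (eq_of_edge_of_isMax hpos (congrFun hy _) (fun j ej => ?_) e).trans h⟩
    exact h.symm ▸ hmax j (hS _ _ hc ej)

/-- A harmonic state is constant on every closed strong component. -/
theorem IsClosedStrongComponent.exists_eq_const (hpos : G.PositiveWeights) {y : V → ℝ}
    (hy : G.diffusion y = 0) {S : Set V} (hS : G.IsClosedStrongComponent S) :
    ∃ c, ∀ k ∈ S, y k = c := by
  have hcl : ∀ a, ∀ b ∈ S, G.Edge a b → a ∈ S :=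
    fun a b hb e => by_contra fun ha => hS.2 a ha b hb e
  obtain ⟨m, hm, hmax⟩ := Set.exists_max_image S y (Set.toFinite S) hS.1.prop.1
  refine ⟨y m, fun k hk => ?_⟩
  by_cases h : k = m
  · rw [h]
  · refine eq_of_hasPath_of_isMaxOn hpos hy hcl hm hmax ?_
    exact (hS.1.prop.2 ⟨k, hk⟩ ⟨m, hm⟩ fun e => h (congrArg Subtype.val e)).of_induce

/-- A harmonic state is bounded above by its value at some leader. -/
theorem exists_leader_le (hpos : G.PositiveWeights) {y : V → ℝ} (hy : G.diffusion y = 0)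
    (k : V) : ∃ l ∈ G.leaders, y k ≤ y l := by
  obtain ⟨m, -, hm⟩ := Set.exists_max_image Set.univ y Set.finite_univ ⟨k, trivial⟩
  obtain ⟨l, hl, p⟩ := G.exists_leader_hasPath m
  refine ⟨l, hl, ?_⟩
  -- The leader `l` upstream of a global maximizer `m` shares its value.
  rw [eq_of_hasPath_of_isMaxOn hpos hy (S := Set.univ) (fun _ _ _ _ => trivial) trivial hm p]
  exact hm k trivial

/-- The values of a harmonic state lie in the convex hull of its values at the leaders. -/
theorem mem_convexHull_leaders (hpos : G.PositiveWeights) {y : V → ℝ} (hy : G.diffusion y = 0)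
    (k : V) : y k ∈ convexHull ℝ (y '' G.leaders) := by
  obtain ⟨a, ha, hka⟩ := exists_leader_le hpos hy k
  -- The lower bound is the upper bound for `-y`.
  have hy' : G.diffusion (-y) = 0 := by
    ext j
    rw [diffusion_neg, hy, Pi.zero_apply, neg_zero]
  obtain ⟨b, hb, hkb⟩ := exists_leader_le hpos hy' k
  have hseg := (convex_convexHull ℝ (y '' G.leaders)).ordConnected.out
    (subset_convexHull ℝ _ ⟨b, hb, rfl⟩) (subset_convexHull ℝ _ ⟨a, ha, rfl⟩)
  exact hseg ⟨neg_le_neg_iff.mp hkb, hka⟩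

end Laplacian

end SignedDigraph

/-! ### The singular gain -/

/-- The exponent `1 / κ` undoes the power `κ` in `phi`, so a simple pole at `T` remains whatever `κ`
is. -/
theorem phiDot_div_phi_of_lt {κ T t : ℝ} (hκ : 0 < κ) (hT : 0 < T) (ht : t < T) :
    phiDot κ T t / phi κ T t = κ / (T - t) := by
  have hs : 0 < T - t := sub_pos.mpr ht
  have hphi : phi κ T t = (T / (T - t)) ^ κ := by
    rw [phi, if_pos ht, Real.div_rpow hT.le hs.le]
  have hpos : 0 < phi κ T t := hphi ▸ Real.rpow_pos_of_pos (div_pos hT hs) κ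
  have hroot : phi κ T t ^ (1 / κ) = T / (T - t) := by
    rw [hphi, one_div, Real.rpow_rpow_inv (div_pos hT hs).le hκ.ne']
  rw [phiDot, if_pos ht, Real.rpow_add hpos, Real.rpow_one, hroot]
  field_simp

theorem phiDot_of_le {κ T t : ℝ} (ht : T ≤ t) : phiDot κ T t = 0 := if_neg ht.not_gt

/-- A function continuous at `T` from the left cannot have a derivative bounded below by
`c / (T - t)` with `c > 0` near `T`, since the latter has a divergent integral. -/
theorem not_continuousAt_of_div_le_deriv {f f' : ℝ → ℝ} {a c T : ℝ} (haT : a < T) (hc : 0 < c)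
    (hf : ∀ t ∈ Set.Ico a T, HasDerivAt f (f' t) t)
    (hf' : ∀ t ∈ Set.Ico a T, c / (T - t) ≤ f' t) : ¬ ContinuousAt f T := by
  intro hcont
  have hd : ∀ t ∈ Set.Ico a T,
      HasDerivAt (fun t => f t + c * Real.log (T - t)) (f' t + c * (-1 / (T - t))) t := by
    intro t ht
    exact (hf t ht).add ((((hasDerivAt_id t).const_sub T).log (sub_pos.mpr ht.2).ne').const_mul c)
  -- The logarithm absorbs the lower bound on `f'`; the sum increases, yet continuity of `f` at `T`
  -- would send it to `-∞`.
  have hmono : MonotoneOn (fun t => f t + c * Real.log (T - t)) (Set.Ico a T) := by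
    refine monotoneOn_of_deriv_nonneg (convex_Ico a T)
      (fun t ht => (hd t ht).continuousAt.continuousWithinAt)
      (fun t ht => (hd t (interior_subset ht)).differentiableAt.differentiableWithinAt) ?_
    intro t ht
    rw [(hd t (interior_subset ht)).deriv]
    have := hf' t (interior_subset ht)
    have e : c * (-1 / (T - t)) = -(c / (T - t)) := by ring
    linarith
  have hlog : Tendsto (fun t => Real.log (T - t)) (𝓝[<] T) atBot := by
    refine Real.tendsto_log_nhdsGT_zero.comp ?_
    refine tendsto_nhdsWithin_iff.mpr ⟨?_, ?_⟩
    · have : Tendsto (fun t : ℝ => T - t) (𝓝 T) (𝓝 (T - T)) :=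
        (continuous_const.sub continuous_id).tendsto T
      rw [sub_self] at this
      exact this.mono_left nhdsWithin_le_nhds
    · filter_upwards [self_mem_nhdsWithin] with t ht
      exact sub_pos.mpr (Set.mem_Iio.mp ht)
  have hbot : Tendsto (fun t => f t + c * Real.log (T - t)) (𝓝[<] T) atBot :=
    (hcont.tendsto.mono_left nhdsWithin_le_nhds).add_atBot (hlog.const_mul_atBot hc)
  have hev : ∀ᶠ t in 𝓝[<] T,
      f a + c * Real.log (T - a) ≤ f t + c * Real.log (T - t) := by
    filter_upwards [Ico_mem_nhdsLT haT] with t ht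
    exact hmono ⟨le_rfl, haT⟩ ht ht.1
  obtain ⟨t, ht, ht'⟩ :=
    (hev.and (hbot.eventually_lt_atBot (f a + c * Real.log (T - a)))).exists
  exact absurd ht ht'.not_ge

/-! ### Trajectories at and after the prescribed time -/

namespace IsTrajectory

variable {V : Type*} [Fintype V] {G : SignedDigraph V} {ρ₁ ρ₂ κ T : ℝ} {x : ℝ → V → ℝ}

theorem continuousAt (hx : IsTrajectory G ρ₁ ρ₂ κ T x) {t : ℝ} (ht : 0 < t) :
    ContinuousAt x t :=
  hx.continuousOn.continuousAt (Ici_mem_nhds ht)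

theorem hasDerivAt_of_lt (hx : IsTrajectory G ρ₁ ρ₂ κ T x) (hpos : G.PositiveWeights)
    (hκ : 0 < κ) {t : ℝ} (ht : 0 < t) (htT : t < T) (k : V) :
    HasDerivAt (fun s => x s k) ((ρ₁ + ρ₂ * (κ / (T - t))) * G.diffusion (x t) k) t := by
  have h := (hx.hasDeriv t ht.le htT.ne k).hasDerivAt (Ici_mem_nhds ht)
  rwa [SignedDigraph.protocol_eq_diffusion hpos,
    phiDot_div_phi_of_lt hκ (ht.trans htT) htT] at h

theorem hasDerivAt_of_gt (hx : IsTrajectory G ρ₁ ρ₂ κ T x) (hpos : G.PositiveWeights)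
    (hT : 0 < T) {t : ℝ} (ht : T < t) (k : V) :
    HasDerivAt (fun s => x s k) (ρ₁ * G.diffusion (x t) k) t := by
  have h := (hx.hasDeriv t (hT.trans ht).le ht.ne' k).hasDerivAt (Ici_mem_nhds (hT.trans ht))
  rwa [SignedDigraph.protocol_eq_diffusion hpos, phiDot_of_le ht.le, zero_div, mul_zero,
    add_zero] at h

/-- This symmetry turns the one-sided bound `diffusion_nonpos` into an equality. -/
theorem neg (hx : IsTrajectory G ρ₁ ρ₂ κ T x) (hpos : G.PositiveWeights) :
    IsTrajectory G ρ₁ ρ₂ κ T (fun t => -x t) where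
  continuousOn := hx.continuousOn.neg
  hasDeriv t ht htT k := by
    have h := (hx.hasDeriv t ht htT k).neg
    rw [SignedDigraph.protocol_eq_diffusion hpos, ← mul_neg, ← SignedDigraph.diffusion_neg,
      ← SignedDigraph.protocol_eq_diffusion hpos] at h
    exact h

/-- A positive value would, by continuity, exceed some `ε > 0` just before `T`, making the velocity
at least `ρ₂ * κ * ε / (T - t)`. -/
theorem diffusion_nonpos (hx : IsTrajectory G ρ₁ ρ₂ κ T x) (hpos : G.PositiveWeights)
    (hρ₁ : 0 < ρ₁) (hρ₂ : 0 < ρ₂) (hκ : 0 < κ) (hT : 0 < T) (k : V) :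
    G.diffusion (x T) k ≤ 0 := by
  by_contra! hlt
  set ε := G.diffusion (x T) k / 2 with hε
  have hε0 : 0 < ε := half_pos hlt
  have hev : ∀ᶠ t in 𝓝 T, ε < G.diffusion (x t) k := by
    have hc : ContinuousAt (fun t => G.diffusion (x t) k) T :=
      ((continuous_apply k).comp G.continuous_diffusion).continuousAt.comp (hx.continuousAt hT)
    exact hc.eventually_const_lt (half_lt_self hlt)
  obtain ⟨b, hbT, hb⟩ := (mem_nhdsLT_iff_exists_Ioo_subset' hT).mp
    (nhdsWithin_le_nhds hev)
  -- The midpoint keeps the closed left end strictly inside `(b, T)`; `T / 2` keeps times positive,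
  -- where derivatives are two-sided.
  have hmax : max ((b + T) / 2) (T / 2) < T := max_lt (add_div_two_lt_right.mpr hbT) (half_lt_self hT)
  have hpos' : ∀ t ∈ Set.Ico (max ((b + T) / 2) (T / 2)) T, 0 < t := fun t ht =>
    (half_pos hT).trans_le ((le_max_right _ _).trans ht.1)
  refine not_continuousAt_of_div_le_deriv hmax (mul_pos (mul_pos hρ₂ hκ) hε0)
    (fun t ht => hx.hasDerivAt_of_lt hpos hκ (hpos' t ht) ht.2 k) (fun t ht => ?_)
    ((continuous_apply k).continuousAt.comp (hx.continuousAt hT))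
  have hlow : ε < G.diffusion (x t) k := 
    hb ⟨(left_lt_add_div_two.mpr hbT).trans_le ((le_max_left _ _).trans ht.1), ht.2⟩
  have hgain : 0 < ρ₂ * (κ / (T - t)) := mul_pos hρ₂ (div_pos hκ (sub_pos.mpr ht.2))
  calc ρ₂ * κ * ε / (T - t) = ρ₂ * (κ / (T - t)) * ε := by ring
    _ ≤ (ρ₁ + ρ₂ * (κ / (T - t))) * G.diffusion (x t) k :=
      mul_le_mul (le_add_of_nonneg_left hρ₁.le) hlow.le hε0.le (by linarith)

/-- The state at the prescribed time is an equilibrium of the diffusion. -/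
theorem diffusion_eq_zero (hx : IsTrajectory G ρ₁ ρ₂ κ T x) (hpos : G.PositiveWeights)
    (hρ₁ : 0 < ρ₁) (hρ₂ : 0 < ρ₂) (hκ : 0 < κ) (hT : 0 < T) : G.diffusion (x T) = 0 := by
  ext k
  refine le_antisymm (hx.diffusion_nonpos hpos hρ₁ hρ₂ hκ hT k) ?_
  have h := (hx.neg hpos).diffusion_nonpos hpos hρ₁ hρ₂ hκ hT k
  rw [SignedDigraph.diffusion_neg] at h
  exact neg_nonpos.mp h

/-- From the prescribed time on the state is constant. -/
theorem eq_of_le (hx : IsTrajectory G ρ₁ ρ₂ κ T x) (hpos : G.PositiveWeights)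
    (hρ₁ : 0 < ρ₁) (hρ₂ : 0 < ρ₂) (hκ : 0 < κ) (hT : 0 < T) {t : ℝ} (ht : T ≤ t) :
    x t = x T := by
  have hzero := hx.diffusion_eq_zero hpos hρ₁ hρ₂ hκ hT
  have hcont : ContinuousOn x (Set.Icc T t) :=
    hx.continuousOn.mono fun s hs => hT.le.trans hs.1
  have hder : ∀ s ∈ Set.Ico T t,
      HasDerivWithinAt x ((ρ₁ • G.diffusionCLM) (x s)) (Set.Ici s) s := by
    intro s hs
    rw [hasDerivWithinAt_pi]
    intro k
    change HasDerivWithinAt (fun s => x s k) (ρ₁ * G.diffusion (x s) k) _ _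
    rcases hs.1.eq_or_lt with rfl | hlt
    -- The equation is not assumed at `T`; the right derivative there is the limit of the
    -- derivatives at later times.
    · have hc : ContinuousAt (fun s => x s k) T :=
        (continuous_apply k).continuousAt.comp (hx.continuousAt hT)
      refine hasDerivWithinAt_Ici_of_tendsto_deriv (s := Set.Ioi T)
        (fun s hs => (hx.hasDerivAt_of_gt hpos hT hs k).differentiableAt.differentiableWithinAt)
        hc.continuousWithinAt self_mem_nhdsWithin ?_
      have hd : ContinuousAt (fun s => ρ₁ * G.diffusion (x s) k) T :=
        (((continuous_apply k).comp G.continuous_diffusion).continuousAt.comp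
          (hx.continuousAt hT)).const_mul ρ₁
      refine (hd.tendsto.mono_left nhdsWithin_le_nhds).congr' ?_
      filter_upwards [self_mem_nhdsWithin] with s hs
      exact (hx.hasDerivAt_of_gt hpos hT hs k).deriv.symm
    · exact (hx.hasDerivAt_of_gt hpos hT hlt k).hasDerivWithinAt
  have hconst : ∀ s ∈ Set.Ico T t, HasDerivWithinAt (fun _ : ℝ => x T)
      ((ρ₁ • G.diffusionCLM) (x T)) (Set.Ici s) s := by
    intro s _
    have : (ρ₁ • G.diffusionCLM) (x T) = 0 := by
      change ρ₁ • G.diffusion (x T) = 0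
      rw [hzero, smul_zero]
    rw [this]
    exact hasDerivWithinAt_const _ _ _
  exact ODE_solution_unique (v := fun _ y => (ρ₁ • G.diffusionCLM) y)
    (fun _ => (ρ₁ • G.diffusionCLM).lipschitz) hcont hder continuousOn_const hconst rfl
    ⟨ht, le_rfl⟩

end IsTrajectory

theorem corollary5 (N : ℕ) (hN : 2 ≤ N) (G : SignedDigraph (Fin N))
    (hG : G.WeaklyConnected) (hpos : G.PositiveWeights)
    (ρ₁ ρ₂ κ T₁ : ℝ) (hρ₁ : 0 < ρ₁) (hρ₂ : 0 < ρ₂) (hκ : 0 < κ) (hT₁ : 0 < T₁)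
    (x : ℝ → Fin N → ℝ) (hx : IsTrajectory G ρ₁ ρ₂ κ T₁ x) :
    (∀ S : Set (Fin N), G.IsClosedStrongComponent S → PrescribedTimeConsensus x T₁ S) ∧
      PrescribedTimeContainment x T₁ G.leaders G.followers := by
  have hzero := hx.diffusion_eq_zero hpos hρ₁ hρ₂ hκ hT₁
  have hconst : ∀ t, T₁ ≤ t → x t = x T₁ := fun t ht => hx.eq_of_le hpos hρ₁ hρ₂ hκ hT₁ ht
  have hlim : ∀ k, Tendsto (fun t => x t k) (𝓝 T₁) (𝓝 (x T₁ k)) :=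
    tendsto_pi_nhds.mp (hx.continuousAt hT₁).tendsto
  refine ⟨fun S hS => ?_, fun l _ => ⟨⟨x T₁ l, hlim l, ?_⟩, fun t ht => ?_⟩⟩
  · obtain ⟨c, hc⟩ := hS.exists_eq_const hpos hzero
    exact ⟨c, fun k hk => ⟨hc k hk ▸ hlim k, fun t ht => by rw [hconst t ht, hc k hk]⟩⟩
  · refine convexHull_mono ?_ (SignedDigraph.mem_convexHull_leaders hpos hzero l)
    rintro _ ⟨k, hk, rfl⟩
    exact ⟨k, hk, hlim k⟩
  · rw [hconst t ht]
    exact SignedDigraph.mem_convexHull_leaders hpos hzero l
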